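/- Let $X$ be a finite set with $|X|\ge 2$ and let $X^*$ be the set of finite words over $X$. A self-similar group over $X$ is a group $\mathfrak G$ of length-preserving permutations of $X^*$ such that for all $g\in\mathfrak G$ and $x\in X$ there is $g|_x\in\mathfrak G$ with $g(xw)=g(x)\,g|_x(w)$ for all $w\in X^*$. For a field $K$, its Nekrashevych algebra $\mathcal N_K(\mathfrak G,X)$ is the unital $*$-algebra over $K$ (with $*$ being $K$-linear) generated by $X\cup\mathfrak G$ subject to the relations $g^*=g^{-1}$, $g\cdot h=gh$ (the identity of $\mathfrak G$ being the unit), $gx=g(x)\,g|_x$, $y^*x=\delta_{x,y}$ and $\sum_{x\in X}xx^*=1$ for $g,h\in\mathfrak G$, $x,y\in X$. It is called simple if it is simple as a ring. Let $m\ge 2$, let $C$ be a cyclic group of order $m$, let $\Phi(m-1)$ be the identity automorphism of $C$, and for $0\le k\le m-2$ let $\Phi(k)\colon C\to\mathbb Z_m$ be a homomorphism. Let $c\in C$ act on words over $X=\mathbb Z_m$ by $c(kw)=k\,\Phi(k)(c)(w)$ for $k\in X$ and $w\in X^*$, where $a\in\mathbb Z_m$ acts on words by $a(kw)=(a+k)w$;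 both fix the empty word. Let $\mathfrak G$ be the self-similar group over $\mathbb Z_m$ generated by all these permutations, for $c\in C$ and $a\in \mathbb Z_m$. If $\bigcap_{k=0}^{m-2}\ker\Phi(k)$ is trivial, then $\mathfrak G$ is called a GGS-group. **Theorem.** Let $\mathfrak G$ be a GGS-group over $\mathbb Z_m$, $m\ge 2$. If $\Phi(k)$ is an isomorphism for some $0\le k\le m-2$, then $\mathcal N_K(\mathfrak G,\mathbb Z_m)$ is simple for every field $K$. Otherwise, $\mathcal N_K(\mathfrak G,\mathbb Z_m)$ is simple for no field $K$. In particular, if $m$ is a prime power, then $\mathcal N_K(\mathfrak G,\mathbb Z_m)$ is simple for every field $K$. This applies to the Gupta–Sidki $p$-groups, that is, to the case in which $m=p$ is an odd prime, $C=\langle t\rangle$, $\Phi(0)(t)=1$, $\Phi(1)(t)=-1$ and $\Phi(k)(t)=0$ for $2\le k\le p-2$. -/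

import Mathlib

/-!
Self-similar groups, their Nekrashevych algebras, multispinal groups and GGS-groups.
Words over the alphabet `X` are elements of `List X`.
-/

universe u v

/-- A self-similar group over the alphabet `X`: a group of length-preserving permutations of the
set of words such that each element `g` has, at each letter `x`, a section `h = g|_x` in the
group, that is, `g(xw) = g(x) g|_x(w)` for all words `w`. -/
structure SelfSimilarGroup (X : Type*) where
  /-- the underlying group of permutations of words -/
  carrier : Subgroup (Equiv.Perm (List X))
  /-- the action is length-preserving -/
  length_apply : ∀ g ∈ carrier, ∀ w : List X, (g w).length = w.length
  /-- the group has all sections -/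
  exists_section : ∀ g ∈ carrier, ∀ x : X, ∃ h ∈ carrier, ∀ w : List X, g (x :: w) = g [x] ++ h w

/-! ### The Nekrashevych algebra -/

/-- Generators of the Nekrashevych algebra: the letters `x`, their adjoints `x^*` and the group
elements `g`. As `g^* = g⁻¹`, no adjoints of the latter are needed. -/
inductive NekGen {X : Type*} (G : SelfSimilarGroup X) where
  | letter (x : X) : NekGen G
  | adj (x : X) : NekGen G
  | grp (g : G.carrier) : NekGen G

/-- The letter `x` in the free algebra. -/
def nekX (K : Type*) [Field K] {X : Type*} (G : SelfSimilarGroup X) (x : X) :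
    FreeAlgebra K (NekGen G) :=
  FreeAlgebra.ι K (NekGen.letter x)

/-- The adjoint `x^*` of the letter `x` in the free algebra. -/
def nekXs (K : Type*) [Field K] {X : Type*} (G : SelfSimilarGroup X) (x : X) :
    FreeAlgebra K (NekGen G) :=
  FreeAlgebra.ι K (NekGen.adj x)

/-- The group element `g` in the free algebra. -/
def nekG (K : Type*) [Field K] {X : Type*} (G : SelfSimilarGroup X) (g : G.carrier) :
    FreeAlgebra K (NekGen G) :=
  FreeAlgebra.ι K (NekGen.grp g)

/-- The defining relations of the Nekrashevych algebra. In `ss` and `ss_adj` the hypothesis says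
that `y = g(x)` and `h = g|_x`. The relation `ss_adj` is the adjoint of `ss`; the other relations
form a set closed under taking adjoints. -/
inductive NekRel (K : Type*) [Field K] {X : Type*} [Fintype X] (G : SelfSimilarGroup X) :
    FreeAlgebra K (NekGen G) → FreeAlgebra K (NekGen G) → Prop
  | grp_one : NekRel K G (nekG K G 1) 1
  | grp_mul (g h : G.carrier) : NekRel K G (nekG K G g * nekG K G h) (nekG K G (g * h))
  | ss (g h : G.carrier) (x y : X) (hs : ∀ w : List X, g.1 (x :: w) = y :: h.1 w) :
      NekRel K G (nekG K G g * nekX K G x) (nekX K G y * nekG K G h)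
  | ss_adj (g h : G.carrier) (x y : X) (hs : ∀ w : List X, g.1 (x :: w) = y :: h.1 w) :
      NekRel K G (nekXs K G x * nekG K G g⁻¹) (nekG K G h⁻¹ * nekXs K G y)
  | ck_same (x : X) : NekRel K G (nekXs K G x * nekX K G x) 1
  | ck_diff (x y : X) (hxy : y ≠ x) : NekRel K G (nekXs K G y * nekX K G x) 0
  | ck_sum : NekRel K G (∑ x : X, nekX K G x * nekXs K G x) 1

/-- The Nekrashevych algebra of the self-similar group `G` over the finite alphabet `X`, with
coefficients in the field `K`. -/
abbrev NekrashevychAlgebra (K : Type*) [Field K] {X : Type*} [Fintype X]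
    (G : SelfSimilarGroup X) : Type _ :=
  RingQuot (NekRel K G)

/-! ### Multispinal groups -/

section Multispinal

variable {G H X : Type*} [Group G] [Group H] [MulAction H X]

/-- The letter written by a state of the automaton of `Φ` on reading a letter: states from `H`
act on letters by the given action, states from `G` fix all letters. -/
def msOut : G ⊕ H → X → X
  | Sum.inl _, x => x
  | Sum.inr h, x => h • x

/-- The section of a state at a letter: `h|_x = 1` and `g|_x = Φ(x)(g)`. -/
def msNext (Φ : X → MulAut G ⊕ (G →* H)) : G ⊕ H → X → G ⊕ H
  | Sum.inl g, x =>
    match Φ x with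
    | Sum.inl α => Sum.inl (α g)
    | Sum.inr f => Sum.inr (f g)
  | Sum.inr _, _ => Sum.inr 1

/-- The action of a state on words. The states `inl 1` and `inr 1` both act as the identity (so
identifying them is not necessary). -/
def msAct (Φ : X → MulAut G ⊕ (G →* H)) : G ⊕ H → List X → List X
  | _, [] => []
  | s, x :: w => msOut s x :: msAct Φ (msNext Φ s x) w

/-- The inverse of a state. -/
def msInv : G ⊕ H → G ⊕ H
  | Sum.inl g => Sum.inl g⁻¹
  | Sum.inr h => Sum.inr h⁻¹

theorem msInv_msInv (s : G ⊕ H) : msInv (msInv s) = s := by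
  cases s <;> simp [msInv]

theorem msAct_msInv (Φ : X → MulAut G ⊕ (G →* H)) (s : G ⊕ H) (w : List X) :
    msAct Φ (msInv s) (msAct Φ s w) = w := by
  induction w generalizing s with
  | nil => simp [msAct]
  | cons x w ih =>
    have h1 : msOut (msInv s) (msOut s x) = x := by
      cases s <;> simp [msInv, msOut]
    have h2 : msNext Φ (msInv s) (msOut s x) = msInv (msNext Φ s x) := by
      cases s with
      | inl g =>
        simp only [msInv, msOut, msNext]
        cases Φ x <;> simp
      | inr h => simp [msInv, msNext]
    simp only [msAct]
    rw [h1, h2, ih]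

/-- The permutation of words given by a state. -/
def msPerm (Φ : X → MulAut G ⊕ (G →* H)) (s : G ⊕ H) : Equiv.Perm (List X) where
  toFun := msAct Φ s
  invFun := msAct Φ (msInv s)
  left_inv := msAct_msInv Φ s
  right_inv w := by
    have h := msAct_msInv Φ (msInv s) w
    rwa [msInv_msInv] at h

theorem length_msAct (Φ : X → MulAut G ⊕ (G →* H)) (s : G ⊕ H) (w : List X) :
    (msAct Φ s w).length = w.length := by
  induction w generalizing s with
  | nil => rfl
  | cons x w ih => simp [msAct, ih]

theorem length_of_mem_closure (Φ : X → MulAut G ⊕ (G →* H)) (g : Equiv.Perm (List X))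
    (hg : g ∈ Subgroup.closure (Set.range (msPerm Φ))) (w : List X) :
    (g w).length = w.length := by
  induction hg using Subgroup.closure_induction generalizing w with
  | mem g hg =>
    obtain ⟨s, rfl⟩ := hg
    exact length_msAct Φ s w
  | one => rfl
  | mul a b _ _ iha ihb => rw [Equiv.Perm.mul_apply, iha, ihb]
  | inv a _ iha =>
    have h := iha (a⁻¹ w)
    rw [show a (a⁻¹ w) = w from Equiv.apply_symm_apply a w] at h
    exact h.symm

theorem exists_section_of_mem_closure (Φ : X → MulAut G ⊕ (G →* H)) (g : Equiv.Perm (List X))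
    (hg : g ∈ Subgroup.closure (Set.range (msPerm Φ))) (x : X) :
    ∃ h ∈ Subgroup.closure (Set.range (msPerm Φ)), ∀ w : List X, g (x :: w) = g [x] ++ h w := by
  induction hg using Subgroup.closure_induction generalizing x with
  | mem g hg =>
    obtain ⟨s, rfl⟩ := hg
    exact ⟨msPerm Φ (msNext Φ s x), Subgroup.subset_closure ⟨_, rfl⟩, fun w => rfl⟩
  | one => exact ⟨1, one_mem _, fun w => rfl⟩
  | mul a b _ hb iha ihb =>
    obtain ⟨k, hk, hkw⟩ := ihb x
    obtain ⟨y, hy⟩ := List.length_eq_one_iff.1 (length_of_mem_closure Φ b hb [x])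
    obtain ⟨l, hl, hlw⟩ := iha y
    refine ⟨l * k, mul_mem hl hk, fun w => ?_⟩
    rw [Equiv.Perm.mul_apply, hkw, Equiv.Perm.mul_apply, hy, Equiv.Perm.mul_apply]
    exact hlw (k w)
  | inv a ha iha =>
    obtain ⟨y, hy⟩ := List.length_eq_one_iff.1 (length_of_mem_closure Φ a⁻¹ (inv_mem ha) [x])
    obtain ⟨l, hl, hlw⟩ := iha y
    have hay : a [y] = [x] := by rw [← hy]; exact Equiv.apply_symm_apply a [x]
    refine ⟨l⁻¹, inv_mem hl, fun w => ?_⟩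
    rw [Equiv.Perm.inv_eq_iff_eq, hy, List.singleton_append, hlw, hay, show l (l⁻¹ w) = w from Equiv.apply_symm_apply l w]
    rfl

/-- The self-similar group over `X` generated by the states of the automaton of `Φ`. -/
def multispinalGroup (Φ : X → MulAut G ⊕ (G →* H)) : SelfSimilarGroup X where
  carrier := Subgroup.closure (Set.range (msPerm Φ))
  length_apply := length_of_mem_closure Φ
  exists_section := exists_section_of_mem_closure Φ

/-- The group `A` of automorphisms of `G` generated by the automorphisms among the `Φ(x)`. -/
def msA (Φ : X → MulAut G ⊕ (G →* H)) : Subgroup (MulAut G) :=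
  Subgroup.closure {α | ∃ x, Φ x = Sum.inl α}

/-- The set `B` of all `f ∘ α` with `f` a homomorphism `G → H` among the `Φ(x)` and `α ∈ A`. -/
def msB (Φ : X → MulAut G ⊕ (G →* H)) : Set (G →* H) :=
  {b | ∃ f : G →* H, (∃ x, Φ x = Sum.inr f) ∧ ∃ α ∈ msA Φ, b = f.comp α.toMonoidHom}

/-- The requirements on the data `(G, H, Φ)` of a multispinal group over the alphabet `X`. -/
structure IsMultispinal (Φ : X → MulAut G ⊕ (G →* H)) : Prop where
  finite_left : Finite G
  finite_right : Finite H
  /-- `H` acts freely on `X` -/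
  free : ∀ (h : H) (x : X), h • x = x → h = 1
  exists_aut : ∃ x α, Φ x = Sum.inl α
  exists_hom : ∃ x f, Φ x = Sum.inr f
  /-- the homomorphisms in `B` have trivial common kernel -/
  ker_trivial : ∀ g : G, (∀ b ∈ msB Φ, b g = 1) → g = 1

end Multispinal

/-! ### GGS-groups -/

/-- The data of a GGS-group over the alphabet `ZMod m`: multispinal data in which `G = C` is
cyclic of order `m`, `H = ZMod m` acts on `X = ZMod m` by translation, `Φ(m-1)` is the identity
automorphism of `C` and `Φ(k)` is a homomorphism `C → ZMod m` for `0 ≤ k ≤ m - 2`. -/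
structure IsGGS {m : ℕ} {C : Type*} [Group C]
    (Φ : ZMod m → MulAut C ⊕ (C →* Multiplicative (ZMod m))) : Prop extends
    IsMultispinal Φ where
  cyclic : IsCyclic C
  card_eq : Nat.card C = m
  last : Φ ((m - 1 : ℕ) : ZMod m) = Sum.inl (MulEquiv.refl C)
  hom : ∀ k : ℕ, k + 2 ≤ m → ∃ f, Φ (k : ZMod m) = Sum.inr f

/-- The data of the Gupta-Sidki `p`-group, `p` an odd prime: `C` is cyclic of order `p` with
generator `t`, `Φ(p-1)` is the identity automorphism of `C`, and `Φ(0), ..., Φ(p-2)` are the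
homomorphisms `C → ZMod p` that send `t` to `1, -1, 0, ..., 0`. -/
structure IsGuptaSidki {p : ℕ} {C : Type*} [Group C] (t : C)
    (Φ : ZMod p → MulAut C ⊕ (C →* Multiplicative (ZMod p))) : Prop where
  prime : p.Prime
  ne_two : p ≠ 2
  gen : Subgroup.zpowers t = ⊤
  card_eq : Nat.card C = p
  last : Φ ((p - 1 : ℕ) : ZMod p) = Sum.inl (MulEquiv.refl C)
  zero : ∃ f, Φ 0 = Sum.inr f ∧ f t = Multiplicative.ofAdd 1
  one : ∃ f, Φ 1 = Sum.inr f ∧ f t = Multiplicative.ofAdd (-1)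
  rest : ∀ k : ℕ, 2 ≤ k → k + 2 ≤ p →
    ∃ f, Φ (k : ZMod p) = Sum.inr f ∧ f t = Multiplicative.ofAdd 0

/-! Write z for the letter `m - 1`. Since Φ(z) is the identity, the states from C commute with z in
the algebra.

Simplicity. Right multiplication by letters moves a non-zero element of an ideal J into the span of
products of a word and a state without making it zero (`Contracted.all`, `exists_mem_wordStates`).
Corners y* a x then extract coefficients. As H acts freely, the corner at (hz, z) sends a
combination of states from H to its coefficient at h. The corner at a letter o with Φ(o) injective
carries the combinations of states from C to those from H without loss of coefficients. This leaves
a non-zero scalar plus terms with non-empty words. For large k the corner by z^k o kills these terms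
and keeps the scalar (`exists_corner_eq_zero`), so J contains 1. If no terms with empty word are
present, left multiplication by some x* shortens the words (`one_mem_of_mem_wordStates`).

Non-simplicity. If no Φ(k) is injective, the product of the 1 - c_p, with c_p in C of order p for
the primes p dividing m, has a coefficient function A orthogonal to all functions on C invariant
under a non-trivial element (`exists_annihilating_function`). On each infinite word C acts through
some Φ(k), or trivially if the word is zzz..., so the element with coefficients A(c) at c⁻¹ acts as
zero on functions on infinite words. It is non-zero in the algebra, because it acts non-trivially
once infinite words carry labels in C that are multiplied by germs (`germ`, `repLabel`). Thus the
first representation has a non-zero proper kernel.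

Prime powers. All elements of order p lie in the kernel of every non-injective Φ(k), so a trivial
common kernel forces some Φ(k) to be injective. -/

namespace SelfSimilarGroup

/-! ### Sections and the action on infinite words -/

variable {X : Type*} (G : SelfSimilarGroup X)

theorem exists_out_sec (g : G.carrier) (x : X) :
    ∃ p : X × G.carrier, ∀ w, g.1 (x :: w) = p.1 :: p.2.1 w := by
  obtain ⟨h, hh, hw⟩ := G.exists_section g.1 g.2 x
  obtain ⟨y, hy⟩ := List.length_eq_one_iff.1 (G.length_apply g.1 g.2 [x])
  exact ⟨(y, ⟨h, hh⟩), fun w => by rw [hw, hy]; rfl⟩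

/-- The letter `g(x)`. -/
noncomputable def out (g : G.carrier) (x : X) : X := (G.exists_out_sec g x).choose.1

/-- The section `g|_x`. -/
noncomputable def sec (g : G.carrier) (x : X) : G.carrier := (G.exists_out_sec g x).choose.2

theorem apply_cons (g : G.carrier) (x : X) (w : List X) :
    g.1 (x :: w) = G.out g x :: (G.sec g x).1 w :=
  (G.exists_out_sec g x).choose_spec w

variable {G}

theorem out_eq {g h : G.carrier} {x y : X} (hs : ∀ w, g.1 (x :: w) = y :: h.1 w) :
    G.out g x = y := by
  have := hs []
  rw [apply_cons] at this
  exact (List.cons.inj this).1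

theorem sec_eq {g h : G.carrier} {x y : X} (hs : ∀ w, g.1 (x :: w) = y :: h.1 w) :
    G.sec g x = h := by
  apply Subtype.ext
  ext1 w
  have := hs w
  rw [apply_cons] at this
  exact (List.cons.inj this).2

theorem mul_apply_cons (g h : G.carrier) (x : X) (w : List X) :
    (g * h).1 (x :: w) = G.out g (G.out h x) :: (G.sec g (G.out h x) * G.sec h x).1 w := by
  change g.1 (h.1 (x :: w)) = _
  rw [apply_cons, apply_cons]
  rfl

theorem out_mul (g h : G.carrier) (x : X) : G.out (g * h) x = G.out g (G.out h x) :=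
  out_eq (mul_apply_cons g h x)

theorem sec_mul (g h : G.carrier) (x : X) :
    G.sec (g * h) x = G.sec g (G.out h x) * G.sec h x :=
  sec_eq (mul_apply_cons g h x)

theorem out_one (x : X) : G.out 1 x = x := out_eq (h := 1) fun _ => rfl

theorem sec_one (x : X) : G.sec 1 x = 1 := sec_eq (y := x) fun _ => rfl

/-- The action on infinite words. -/
noncomputable def act (g : G.carrier) (w : ℕ → X) : ℕ → X
  | 0 => G.out g (w 0)
  | n + 1 => act (G.sec g (w 0)) (fun i => w (i + 1)) n

/-- The section of `g` at the prefix of length `n` of an infinite word. -/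
noncomputable def secPrefix (g : G.carrier) (w : ℕ → X) : ℕ → G.carrier
  | 0 => g
  | n + 1 => secPrefix (G.sec g (w 0)) (fun i => w (i + 1)) n

theorem act_one (w : ℕ → X) : act (1 : G.carrier) w = w := by
  funext n
  induction n generalizing w with
  | zero => exact out_one _
  | succ n ih => rw [act, sec_one, ih]

theorem act_mul (g h : G.carrier) (w : ℕ → X) : act (g * h) w = act g (act h w) := by
  funext n
  induction n generalizing w g h with
  | zero => exact out_mul _ _ _
  | succ n ih => rw [act, sec_mul, ih]; rfl

theorem secPrefix_one (w : ℕ → X) (n : ℕ) : secPrefix (1 : G.carrier) w n = 1 := by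
  induction n generalizing w with
  | zero => rfl
  | succ n ih => rw [secPrefix, sec_one, ih]

theorem secPrefix_mul (g h : G.carrier) (w : ℕ → X) (n : ℕ) :
    secPrefix (g * h) w n = secPrefix g (act h w) n * secPrefix h w n := by
  induction n generalizing w g h with
  | zero => rfl
  | succ n ih => rw [secPrefix, sec_mul, ih]; rfl

end SelfSimilarGroup

/-! ### The Nekrashevych algebra and its representations on self-similar sets -/

namespace NekrashevychAlgebra

variable (K : Type*) [Field K] {X : Type*} [Fintype X] (G : SelfSimilarGroup X)

/-- The quotient map from the free algebra. -/
noncomputable def mk : FreeAlgebra K (NekGen G) →ₐ[K] NekrashevychAlgebra K G :=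
  RingQuot.mkAlgHom K (NekRel K G)

/-- The letter `x` in the Nekrashevych algebra. -/
noncomputable def letter (x : X) : NekrashevychAlgebra K G := mk K G (nekX K G x)

/-- The adjoint of the letter `x` in the Nekrashevych algebra. -/
noncomputable def adj (x : X) : NekrashevychAlgebra K G := mk K G (nekXs K G x)

/-- The group embedded in the Nekrashevych algebra. -/
noncomputable def grp : G.carrier →* NekrashevychAlgebra K G where
  toFun g := mk K G (nekG K G g)
  map_one' := (RingQuot.mkAlgHom_rel K NekRel.grp_one).trans (map_one _)
  map_mul' g h := by
    rw [← map_mul]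
    exact (RingQuot.mkAlgHom_rel K (NekRel.grp_mul g h)).symm

theorem grp_mul_letter {g h : G.carrier} {x y : X} (hs : ∀ w, g.1 (x :: w) = y :: h.1 w) :
    grp K G g * letter K G x = letter K G y * grp K G h := by
  have := RingQuot.mkAlgHom_rel K (NekRel.ss (K := K) g h x y hs)
  rwa [map_mul, map_mul] at this

theorem adj_mul_letter_same (x : X) : adj K G x * letter K G x = 1 := by
  have := RingQuot.mkAlgHom_rel K (NekRel.ck_same (K := K) (G := G) x)
  rwa [map_mul, map_one] at this

theorem adj_mul_letter_ne {x y : X} (h : y ≠ x) : adj K G y * letter K G x = 0 := by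
  have := RingQuot.mkAlgHom_rel K (NekRel.ck_diff (K := K) (G := G) x y h)
  rwa [map_mul, map_zero] at this

theorem sum_letter_mul_adj : ∑ x, letter K G x * adj K G x = 1 := by
  have := RingQuot.mkAlgHom_rel K (NekRel.ck_sum (K := K) (G := G))
  rw [map_sum, map_one] at this
  simp only [map_mul] at this
  exact this

/-- Induction principle: a predicate holds everywhere if it holds for `1` and is stable under
linear combinations and under left multiplication by the generators. -/
theorem induction_left {P : NekrashevychAlgebra K G → Prop} (one : P 1)
    (add : ∀ a b, P a → P b → P (a + b)) (smul : ∀ (k : K) a, P a → P (k • a))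
    (hletter : ∀ x a, P a → P (letter K G x * a)) (hadj : ∀ x a, P a → P (adj K G x * a))
    (hgrp : ∀ g a, P a → P (grp K G g * a)) (a : NekrashevychAlgebra K G) : P a := by
  suffices H : ∀ f : FreeAlgebra K (NekGen G), ∀ a, P a → P (mk K G f * a) by
    obtain ⟨f, rfl⟩ := RingQuot.mkAlgHom_surjective K (NekRel K G) a
    have := H f 1 one
    rwa [mul_one] at this
  intro f
  induction f using FreeAlgebra.induction with
  | grade0 k =>
    intro a ha
    rw [AlgHom.commutes, ← Algebra.smul_def]
    exact smul k a ha
  | grade1 x =>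
    intro a ha
    cases x with
    | letter x => exact hletter x a ha
    | adj x => exact hadj x a ha
    | grp g => exact hgrp g a ha
  | mul f g hf hg =>
    intro a ha
    rw [map_mul, mul_assoc]
    exact hf _ (hg _ ha)
  | add f g hf hg =>
    intro a ha
    rw [map_add, add_mul]
    exact add _ _ (hf _ ha) (hg _ ha)

section Representation

variable {G}
variable {Y : Type*} (e : Y ≃ X × Y) (φ : G.carrier → Y → Y)

/-- The operators on functions `Y → K` attached to the generators, where `Y` is a `G`-set
decomposed into copies of itself indexed by the letters. -/
noncomputable def repGen : NekGen G → Module.End K (Y → K)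
  | NekGen.letter x => by
    classical exact
    { toFun := fun f t => if (e t).1 = x then f (e t).2 else 0
      map_add' := fun f g => by funext t; simp only [Pi.add_apply]; split_ifs <;> simp
      map_smul' := fun k f => by
        funext t; simp only [Pi.smul_apply, RingHom.id_apply]; split_ifs <;> simp }
  | NekGen.adj x => LinearMap.funLeft K K fun t => e.symm (x, t)
  | NekGen.grp g => LinearMap.funLeft K K (φ g⁻¹)

omit [Fintype X] in
theorem repGen_letter [DecidableEq X] (x : X) (f : Y → K) (t : Y) :
    repGen K e φ (NekGen.letter x) f t = if (e t).1 = x then f (e t).2 else 0 := by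
  simp only [repGen, LinearMap.coe_mk, AddHom.coe_mk]
  congr

variable (one : ∀ t, φ 1 t = t) (mul : ∀ g h t, φ (g * h) t = φ g (φ h t))
  (compat : ∀ g h x y, (∀ w, g.1 (x :: w) = y :: h.1 w) →
    ∀ t, φ g (e.symm (x, t)) = e.symm (y, φ h t))

include one mul compat in
-- The letters extend functions by zero from the pieces of the partition of `Y`, which gives the
-- relations without group elements; `compat` is the relation `gx = g(x) g|_x` on points.
theorem repGen_rel {a b : FreeAlgebra K (NekGen G)} (h : NekRel K G a b) :
    FreeAlgebra.lift K (repGen K e φ) a = FreeAlgebra.lift K (repGen K e φ) b := by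
  classical
  have inv_apply : ∀ g t, φ g⁻¹ (φ g t) = t := fun g t => by rw [← mul, inv_mul_cancel, one]
  have apply_inv : ∀ g t, φ g (φ g⁻¹ t) = t := fun g t => by rw [← mul, mul_inv_cancel, one]
  ext f t
  cases h with
  | grp_one =>
    simp [nekG, repGen, LinearMap.funLeft, one]
  | grp_mul g h =>
    simp [nekG, repGen, LinearMap.funLeft, mul]
  | ss g h x y hs =>
    simp only [nekG, nekX, map_mul, FreeAlgebra.lift_ι_apply, Module.End.mul_apply,
      repGen_letter]
    simp only [repGen, LinearMap.funLeft_apply]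
    obtain ⟨⟨y', t⟩, rfl⟩ := e.symm.surjective t
    -- Under g⁻¹ the piece of y goes to the piece of x. Points of other pieces do not land there, so
    -- both sides vanish at them.
    by_cases hy : y' = y
    · subst hy
      have : φ g⁻¹ (e.symm (y', t)) = e.symm (x, φ h⁻¹ t) := by
        rw [← apply_inv h t, ← compat g h x y' hs, inv_apply, apply_inv]
      simp [this]
    · have : (e (φ g⁻¹ (e.symm (y', t)))).1 ≠ x := by
        intro hx
        apply hy
        have h1 : φ g⁻¹ (e.symm (y', t)) = e.symm (x, (e (φ g⁻¹ (e.symm (y', t)))).2) := by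
          rw [Equiv.eq_symm_apply, ← hx]
        have h2 := congrArg (φ g) h1
        rw [apply_inv, compat g h x y hs] at h2
        exact congrArg Prod.fst (e.symm.injective h2)
      simp [this, hy]
  | ss_adj g h x y hs =>
    simp [nekG, nekXs, repGen, LinearMap.funLeft, compat g h x y hs]
  | ck_same x =>
    simp only [nekXs, nekX, map_mul, FreeAlgebra.lift_ι_apply, Module.End.mul_apply]
    simp [repGen, LinearMap.funLeft]
  | ck_diff x y hxy =>
    simp only [nekXs, nekX, map_mul, FreeAlgebra.lift_ι_apply, Module.End.mul_apply]
    simp [repGen, LinearMap.funLeft, hxy]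
  | ck_sum =>
    simp only [nekXs, nekX, map_mul, FreeAlgebra.lift_ι_apply, map_sum, map_one,
      Module.End.one_apply, LinearMap.sum_apply, Module.End.mul_apply, Finset.sum_apply,
      repGen_letter, Finset.sum_ite_eq, Finset.mem_univ, if_true]
    simp [repGen, LinearMap.funLeft]

/-- The representation of the Nekrashevych algebra on functions on a `G`-set decomposed into
copies of itself indexed by the letters. -/
noncomputable def rep : NekrashevychAlgebra K G →ₐ[K] Module.End K (Y → K) :=
  RingQuot.liftAlgHom K
    ⟨FreeAlgebra.lift K (repGen K e φ), fun _ _ h => repGen_rel K e φ one mul compat h⟩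

theorem rep_grp_apply (g : G.carrier) (f : Y → K) (t : Y) :
    rep K e φ one mul compat (grp K G g) f t = f (φ g⁻¹ t) := by
  simp only [rep, grp, mk, MonoidHom.coe_mk, OneHom.coe_mk, RingQuot.liftAlgHom_mkAlgHom_apply,
    nekG, FreeAlgebra.lift_ι_apply]
  rfl

end Representation

/-- Splitting off the first letter of an infinite word. -/
def consEquiv (X : Type*) : (ℕ → X) ≃ X × (ℕ → X) where
  toFun w := (w 0, fun i => w (i + 1))
  invFun p := fun n => Nat.casesOn n p.1 p.2
  left_inv w := by funext n; cases n <;> rfl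
  right_inv p := rfl

open SelfSimilarGroup

omit [Fintype X] in
theorem act_consEquiv_symm {G : SelfSimilarGroup X} (g h : G.carrier) (x y : X)
    (hs : ∀ w, g.1 (x :: w) = y :: h.1 w) (t : ℕ → X) :
    act g ((consEquiv X).symm (x, t)) = (consEquiv X).symm (y, act h t) := by
  funext n
  cases n with
  | zero => exact out_eq hs
  | succ n =>
    change act (G.sec g x) t n = act h t n
    rw [sec_eq hs]

/-- The representation on functions on infinite words. -/
noncomputable def repWords : NekrashevychAlgebra K G →ₐ[K] Module.End K ((ℕ → X) → K) :=
  rep K (consEquiv X) act act_one act_mul act_consEquiv_symm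

instance [Nonempty X] : Nontrivial (NekrashevychAlgebra K G) :=
  (repWords K G).toRingHom.domain_nontrivial

end NekrashevychAlgebra

/-! ### The states of the automaton as group elements -/

section States

variable {G H X : Type*} [Group G] [Group H] [MulAction H X] (Φ : X → MulAut G ⊕ (G →* H))

theorem msAct_inr_one (w : List X) : msAct Φ (Sum.inr 1) w = w := by
  induction w with
  | nil => rfl
  | cons x w ih => simp only [msAct, msOut, msNext, one_smul, ih]

theorem msAct_inl_one (w : List X) : msAct Φ (Sum.inl 1) w = w := by
  induction w with
  | nil => rfl
  | cons x w ih =>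
    simp only [msAct, msOut, msNext]
    cases Φ x <;> simp [ih, msAct_inr_one]

theorem msAct_inr_mul (g h : H) (w : List X) :
    msAct Φ (Sum.inr (g * h)) w = msAct Φ (Sum.inr g) (msAct Φ (Sum.inr h) w) := by
  cases w with
  | nil => rfl
  | cons x w => simp only [msAct, msOut, msNext, mul_smul, msAct_inr_one]

theorem msAct_inl_mul (g h : G) (w : List X) :
    msAct Φ (Sum.inl (g * h)) w = msAct Φ (Sum.inl g) (msAct Φ (Sum.inl h) w) := by
  induction w generalizing g h with
  | nil => rfl
  | cons x w ih =>
    simp only [msAct, msOut, msNext]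
    cases Φ x <;> simp [ih, msAct_inr_mul]

/-- A state of the automaton as an element of the group. -/
def msElem (s : G ⊕ H) : (multispinalGroup Φ).carrier :=
  ⟨msPerm Φ s, Subgroup.subset_closure ⟨s, rfl⟩⟩

theorem msElem_apply_cons (s : G ⊕ H) (x : X) (w : List X) :
    (msElem Φ s).1 (x :: w) = msOut s x :: (msElem Φ (msNext Φ s x)).1 w := rfl

/-- The states from `G`. -/
def msElemInl : G →* (multispinalGroup Φ).carrier where
  toFun g := msElem Φ (Sum.inl g)
  map_one' := Subtype.ext (Equiv.ext (msAct_inl_one Φ))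
  map_mul' g h := Subtype.ext (Equiv.ext (msAct_inl_mul Φ g h))

/-- The states from `H`. -/
def msElemInr : H →* (multispinalGroup Φ).carrier where
  toFun g := msElem Φ (Sum.inr g)
  map_one' := Subtype.ext (Equiv.ext (msAct_inr_one Φ))
  map_mul' g h := Subtype.ext (Equiv.ext (msAct_inr_mul Φ g h))

theorem msElem_inv (s : G ⊕ H) : (msElem Φ s)⁻¹ = msElem Φ (msInv s) := by
  cases s with
  | inl g => exact (map_inv (msElemInl Φ) g).symm
  | inr g => exact (map_inv (msElemInr Φ) g).symm

/-- Inverses need no case, because the inverse of a state is a state. -/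
theorem multispinalGroup_induction {P : (multispinalGroup Φ).carrier → Prop}
    (elem : ∀ s, P (msElem Φ s)) (one : P 1) (mul : ∀ g h, P g → P h → P (g * h)) (g) : P g := by
  obtain ⟨g, hg⟩ := g
  change g ∈ Subgroup.closure (Set.range (msPerm Φ)) at hg
  induction hg using Subgroup.closure_induction'' with
  | mem g hg => obtain ⟨s, rfl⟩ := hg; exact elem s
  | inv_mem g hg =>
    obtain ⟨s, rfl⟩ := hg
    have := elem (msInv s)
    rw [← msElem_inv] at this
    exact this
  | one => exact one
  | mul g h hg hh ihg ihh => exact mul _ _ ihg ihh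

end States

/-! ### Contraction to combinations of words times states -/

namespace NekrashevychAlgebra

variable {K : Type*} [Field K]
variable {G H X : Type*} [Group G] [Group H] [MulAction H X] [Fintype X]
variable {Φ : X → MulAut G ⊕ (G →* H)}

variable (K Φ) in
/-- A state of the automaton in the Nekrashevych algebra. -/
noncomputable def state (s : G ⊕ H) : NekrashevychAlgebra K (multispinalGroup Φ) :=
  grp K _ (msElem Φ s)

variable (K Φ) in
/-- A word in the Nekrashevych algebra. -/
noncomputable def word (u : List X) : NekrashevychAlgebra K (multispinalGroup Φ) :=
  (u.map (letter K _)).prod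

@[simp] theorem word_nil : word K Φ [] = 1 := rfl

@[simp] theorem word_cons (x : X) (u : List X) :
    word K Φ (x :: u) = letter K _ x * word K Φ u := by simp [word]

theorem state_mul_letter (s : G ⊕ H) (x : X) :
    state K Φ s * letter K _ x = letter K _ (msOut s x) * state K Φ (msNext Φ s x) :=
  grp_mul_letter K _ (msElem_apply_cons Φ s x)

theorem state_inl_one : state K Φ (Sum.inl 1) = 1 := by
  rw [state, ← map_one (grp K (multispinalGroup Φ)), ← map_one (msElemInl Φ)]; rfl

theorem state_inr_one : state K Φ (Sum.inr 1) = 1 := by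
  rw [state, ← map_one (grp K (multispinalGroup Φ)), ← map_one (msElemInr Φ)]; rfl

theorem state_inl_mul (g h : G) :
    state K Φ (Sum.inl (g * h)) = state K Φ (Sum.inl g) * state K Φ (Sum.inl h) := by
  rw [state, state, state, ← map_mul]
  exact congrArg _ (map_mul (msElemInl Φ) g h)

variable (K Φ) in
/-- The combinations of the products of a word of length less than `L` and a state. -/
noncomputable def wordStates (L : ℕ) : Submodule K (NekrashevychAlgebra K (multispinalGroup Φ)) :=
  Submodule.span K {a | ∃ u s, u.length < L ∧ a = word K Φ u * state K Φ s}

variable (K Φ) in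
/-- The combinations of the products of a non-empty word and a state. -/
noncomputable def posWordStates : Submodule K (NekrashevychAlgebra K (multispinalGroup Φ)) :=
  Submodule.span K {a | ∃ u s, u ≠ [] ∧ a = word K Φ u * state K Φ s}

theorem word_mul_state_mem {L : ℕ} {u : List X} (s : G ⊕ H) (h : u.length < L) :
    word K Φ u * state K Φ s ∈ wordStates K Φ L :=
  Submodule.subset_span ⟨u, s, h, rfl⟩

theorem wordStates_mono {L M : ℕ} (h : L ≤ M) : wordStates K Φ L ≤ wordStates K Φ M :=
  Submodule.span_mono fun _ ⟨u, s, hu, ha⟩ => ⟨u, s, hu.trans_le h, ha⟩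

theorem word_append_singleton (u : List X) (x : X) :
    word K Φ (u ++ [x]) = word K Φ u * letter K _ x := by simp [word]

theorem word_mul_state_mul_letter (u : List X) (s : G ⊕ H) (x : X) :
    word K Φ u * state K Φ s * letter K _ x =
      word K Φ (u ++ [msOut s x]) * state K Φ (msNext Φ s x) := by
  rw [mul_assoc, state_mul_letter, ← mul_assoc, word_append_singleton]

theorem mul_letter_mem_wordStates {L : ℕ} {a} (ha : a ∈ wordStates K Φ L) (x : X) :
    a * letter K _ x ∈ wordStates K Φ (L + 1) := by
  induction ha using Submodule.span_induction with
  | mem a ha =>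
    obtain ⟨u, s, hu, rfl⟩ := ha
    rw [word_mul_state_mul_letter]
    exact word_mul_state_mem _ (by simpa using hu)
  | zero => rw [zero_mul]; exact zero_mem _
  | add a b _ _ ha hb => rw [add_mul]; exact add_mem ha hb
  | smul k a _ ha => rw [smul_mul_assoc]; exact Submodule.smul_mem _ _ ha

theorem adj_mul_mul_letter_mem_posWordStates {a} (ha : a ∈ posWordStates K Φ) (x y : X) :
    adj K _ y * a * letter K _ x ∈ posWordStates K Φ := by
  induction ha using Submodule.span_induction with
  | mem a ha =>
    obtain ⟨u, s, hu, rfl⟩ := ha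
    obtain ⟨z, u, rfl⟩ := List.exists_cons_of_ne_nil hu
    rw [mul_assoc, word_mul_state_mul_letter, List.cons_append, word_cons, ← mul_assoc,
      ← mul_assoc]
    by_cases hy : y = z
    · rw [hy, adj_mul_letter_same, one_mul]
      exact Submodule.subset_span ⟨_, _, by simp, rfl⟩
    · rw [adj_mul_letter_ne K _ hy, zero_mul, zero_mul]
      exact zero_mem _
  | zero => rw [mul_zero, zero_mul]; exact zero_mem _
  | add a b _ _ ha hb => rw [mul_add, add_mul]; exact add_mem ha hb
  | smul k a _ ha =>
    rw [mul_smul_comm, smul_mul_assoc]; exact Submodule.smul_mem _ _ ha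

/-- The elements `a` such that `a * w` is a combination of products of words and states for all
long words `w`. -/
inductive Contracted : NekrashevychAlgebra K (multispinalGroup Φ) → Prop
  | base (L : ℕ) (a) (h : a ∈ wordStates K Φ L) : Contracted a
  | step (a) (h : ∀ x, Contracted (a * letter K _ x)) : Contracted a

namespace Contracted

variable {a b : NekrashevychAlgebra K (multispinalGroup Φ)}

theorem mul_letter (ha : Contracted a) (x : X) : Contracted (a * letter K _ x) := by
  cases ha with
  | base L _ h => exact base _ _ (mul_letter_mem_wordStates h x)
  | step _ h => exact h x

/-- Unwinding one summand multiplies the other by a letter as well; a summand already in the span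
stays there, with the length bound raised by one. -/
theorem add (ha : Contracted a) (hb : Contracted b) : Contracted (a + b) := by
  induction ha generalizing b with
  | base L a h =>
    induction hb generalizing L a with
    | base M b h' =>
      exact base (max L M) _ (add_mem (wordStates_mono (le_max_left _ _) h)
        (wordStates_mono (le_max_right _ _) h'))
    | step b _ ih =>
      refine step _ fun x => ?_
      rw [add_mul]
      exact ih x _ _ (mul_letter_mem_wordStates h x)
  | step a _ ih =>
    refine step _ fun x => ?_
    rw [add_mul]
    exact ih x (hb.mul_letter x)

theorem smul (k : K) (ha : Contracted a) : Contracted (k • a) := by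
  induction ha with
  | base L a h => exact base L _ (Submodule.smul_mem _ _ h)
  | step a _ ih => exact step _ fun x => by rw [smul_mul_assoc]; exact ih x

theorem zero : Contracted (0 : NekrashevychAlgebra K (multispinalGroup Φ)) :=
  base 0 _ (zero_mem _)

/-- Closure under left multiplication by `c` can be checked on products of words and states. -/
theorem mul_left {c : NekrashevychAlgebra K (multispinalGroup Φ)}
    (h : ∀ u s, Contracted (c * (word K Φ u * state K Φ s))) (ha : Contracted a) :
    Contracted (c * a) := by
  induction ha with
  | base L a ha =>
    induction ha using Submodule.span_induction with
    | mem a ha => obtain ⟨u, s, _, rfl⟩ := ha; exact h u s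
    | zero => rw [mul_zero]; exact zero
    | add a b _ _ ha hb => rw [mul_add]; exact ha.add hb
    | smul k a _ ha => rw [mul_smul_comm]; exact ha.smul k
  | step a _ ih => exact step _ fun x => by rw [mul_assoc]; exact ih x

theorem word_mul_state (u : List X) (s : G ⊕ H) : Contracted (word K Φ u * state K Φ s) :=
  base (u.length + 1) _ (word_mul_state_mem s (Nat.lt_succ_self _))

theorem state (s : G ⊕ H) : Contracted (state K Φ s) := by
  simpa using word_mul_state (K := K) (Φ := Φ) [] s

theorem letter_mul (x : X) (ha : Contracted a) : Contracted (letter K _ x * a) := by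
  refine mul_left (fun u s => ?_) ha
  rw [← mul_assoc, ← word_cons]
  exact word_mul_state _ _

/-- The adjoint cancels or kills the leading letter. If the word is empty, a further letter moved
past the state provides one. -/
theorem adj_mul (x : X) (ha : Contracted a) : Contracted (adj K _ x * a) := by
  have key : ∀ y (b : NekrashevychAlgebra K (multispinalGroup Φ)), Contracted b →
      Contracted (adj K _ x * (letter K _ y * b)) := by
    intro y b hb
    rw [← mul_assoc]
    by_cases h : x = y
    · rwa [h, adj_mul_letter_same, one_mul]
    · rw [adj_mul_letter_ne K _ h, zero_mul]
      exact zero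
  refine mul_left (fun u s => ?_) ha
  cases u with
  | cons y u =>
    rw [word_cons, mul_assoc]
    exact key _ _ (word_mul_state _ _)
  | nil =>
    refine step _ fun y => ?_
    rw [word_nil, one_mul, mul_assoc, state_mul_letter]
    exact key _ _ (state _)

/-- A product of two states from `G` is a state. If one factor is from `H`, its sections are
trivial, so one more letter leaves a single state. -/
theorem state_mul (t : G ⊕ H) (ha : Contracted a) :
    Contracted (NekrashevychAlgebra.state K Φ t * a) := by
  refine mul_left (fun u s => ?_) ha
  induction u generalizing t with
  | cons y u ih =>
    rw [word_cons, mul_assoc, ← mul_assoc, state_mul_letter, mul_assoc]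
    exact letter_mul _ (ih _)
  | nil =>
    rw [word_nil, one_mul]
    have key : Contracted (NekrashevychAlgebra.state K Φ t * NekrashevychAlgebra.state K Φ s) ∨
        (∃ h, s = Sum.inr h) ∨ ∃ h, t = Sum.inr h := by
      cases t with
      | inr h => exact Or.inr (Or.inr ⟨h, rfl⟩)
      | inl g =>
        cases s with
        | inr h => exact Or.inr (Or.inl ⟨h, rfl⟩)
        | inl h => exact Or.inl (by rw [← state_inl_mul]; exact state _)
    rcases key with h | ⟨h, rfl⟩ | ⟨h, rfl⟩
    · exact h
    · refine step _ fun x => ?_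
      rw [mul_assoc, state_mul_letter, ← mul_assoc, state_mul_letter, mul_assoc]
      refine letter_mul _ ?_
      simp only [msNext, state_inr_one, mul_one]
      exact state _
    · refine step _ fun x => ?_
      rw [mul_assoc, state_mul_letter, ← mul_assoc, state_mul_letter, mul_assoc]
      refine letter_mul _ ?_
      simp only [msNext, state_inr_one, one_mul]
      exact state _

theorem all (a : NekrashevychAlgebra K (multispinalGroup Φ)) : Contracted a := by
  refine induction_left K _ ?_ (fun _ _ => add) (fun k _ => smul k) (fun x _ => letter_mul x)
    (fun x _ => adj_mul x) (fun g a ha => ?_) a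
  · rw [← state_inr_one]; exact state _
  · induction g using multispinalGroup_induction generalizing a with
    | elem s => exact state_mul s ha
    | one => rwa [map_one, one_mul]
    | mul g h hg hh => rw [map_mul, mul_assoc]; exact hg _ (hh _ ha)

end Contracted

theorem exists_mul_letter_ne_zero {a : NekrashevychAlgebra K (multispinalGroup Φ)} (ha : a ≠ 0) :
    ∃ x, a * letter K _ x ≠ 0 := by
  by_contra! h
  apply ha
  rw [← mul_one a, ← sum_letter_mul_adj, Finset.mul_sum]
  exact Finset.sum_eq_zero fun x _ => by rw [← mul_assoc, h, zero_mul]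

theorem exists_adj_mul_ne_zero {a : NekrashevychAlgebra K (multispinalGroup Φ)} (ha : a ≠ 0) :
    ∃ x, adj K _ x * a ≠ 0 := by
  by_contra! h
  apply ha
  rw [← one_mul a, ← sum_letter_mul_adj, Finset.sum_mul]
  exact Finset.sum_eq_zero fun x _ => by rw [mul_assoc, h, mul_zero]

/-- As the xx* sum to 1, some letter keeps the element non-zero; following such letters ends by the
well-foundedness of `Contracted`. -/
theorem exists_mem_wordStates (J : TwoSidedIdeal (NekrashevychAlgebra K (multispinalGroup Φ)))
    {a} (ha : a ≠ 0) (haJ : a ∈ J) : ∃ L, ∃ b ∈ wordStates K Φ L, b ≠ 0 ∧ b ∈ J := by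
  induction Contracted.all a with
  | base L a h => exact ⟨L, a, h, ha, haJ⟩
  | step a _ ih =>
    obtain ⟨x, hx⟩ := exists_mul_letter_ne_zero ha
    exact ih x hx (J.mul_mem_right _ _ haJ)

/-! ### Simplicity when one of the homomorphisms is injective -/

section Simplicity

variable (hfree : ∀ (h : H) (x : X), h • x = x → h = 1)

variable (K Φ) in
/-- The linear map from finitely supported functions on states. -/
noncomputable def combination {S : Type*} (i : S → G ⊕ H) :
    (S →₀ K) →ₗ[K] NekrashevychAlgebra K (multispinalGroup Φ) :=
  Finsupp.linearCombination K fun s => state K Φ (i s)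

theorem combination_single {S : Type*} (i : S → G ⊕ H) (s : S) (k : K) :
    combination K Φ i (Finsupp.single s k) = k • state K Φ (i s) :=
  Finsupp.linearCombination_single _ _ _

/-- The terms with empty word are separated from the rest `b`; the last clause is what lowers the
length in the induction of `one_mem_of_mem_wordStates`. -/
theorem exists_decomposition {L : ℕ} {a} (ha : a ∈ wordStates K Φ (L + 1)) :
    ∃ (A : G →₀ K) (B : H →₀ K), ∃ b ∈ posWordStates K Φ,
      a = combination K Φ Sum.inl A + combination K Φ Sum.inr B + b ∧
      ∀ x, adj K _ x * b ∈ wordStates K Φ L := by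
  induction ha using Submodule.span_induction with
  | mem a ha =>
    obtain ⟨u, s, hu, rfl⟩ := ha
    cases u with
    | nil =>
      cases s with
      | inl g =>
        refine ⟨Finsupp.single g 1, 0, 0, zero_mem _, ?_, fun x => ?_⟩
        · simp [combination_single]
        · rw [mul_zero]; exact zero_mem _
      | inr g =>
        refine ⟨0, Finsupp.single g 1, 0, zero_mem _, ?_, fun x => ?_⟩
        · simp [combination_single]
        · rw [mul_zero]; exact zero_mem _
    | cons y u =>
      refine ⟨0, 0, _, Submodule.subset_span ⟨y :: u, s, by simp, rfl⟩, by simp, fun x => ?_⟩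
      rw [word_cons, ← mul_assoc, ← mul_assoc]
      by_cases h : x = y
      · rw [h, adj_mul_letter_same, one_mul]
        exact word_mul_state_mem _ (by simpa using hu)
      · rw [adj_mul_letter_ne K _ h, zero_mul, zero_mul]
        exact zero_mem _
  | zero =>
    refine ⟨0, 0, 0, zero_mem _, by simp, fun x => ?_⟩
    rw [mul_zero]; exact zero_mem _
  | add a a' _ _ ha ha' =>
    obtain ⟨A, B, b, hb, rfl, h⟩ := ha
    obtain ⟨A', B', b', hb', rfl, h'⟩ := ha'
    refine ⟨A + A', B + B', b + b', add_mem hb hb', ?_, fun x => ?_⟩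
    · rw [map_add, map_add]; abel
    · rw [mul_add]; exact add_mem (h x) (h' x)
  | smul k a _ ha =>
    obtain ⟨A, B, b, hb, rfl, h⟩ := ha
    refine ⟨k • A, k • B, k • b, Submodule.smul_mem _ _ hb, ?_, fun x => ?_⟩
    · rw [map_smul, map_smul, smul_add, smul_add]
    · rw [mul_smul_comm]; exact Submodule.smul_mem _ _ (h x)

include hfree in
/-- Corners of a combination of states from `H` are scalars. -/
theorem adj_mul_combination_inr_mul_letter (B : H →₀ K) (h : H) (x : X) :
    adj K _ (h • x) * combination K Φ Sum.inr B * letter K _ x = B h • 1 := by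
  classical
  induction B using Finsupp.induction_linear with
  | zero => simp
  | add B B' hB hB' => rw [map_add, mul_add, add_mul, hB, hB', ← add_smul]; rfl
  | single g k =>
    rw [combination_single, mul_smul_comm, smul_mul_assoc, mul_assoc, state_mul_letter, ← mul_assoc]
    simp only [msOut, msNext, state_inr_one, mul_one]
    by_cases hg : g = h
    · rw [hg, adj_mul_letter_same, Finsupp.single_eq_same]
    · rw [adj_mul_letter_ne, Finsupp.single_eq_of_ne (Ne.symm hg), zero_smul, smul_zero]
      intro he
      apply hg
      have := hfree (h⁻¹ * g) x (by rw [mul_smul, ← he, inv_smul_smul])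
      exact (inv_mul_eq_one.1 this).symm

theorem adj_mul_combination_inl_mul_letter_ne (A : G →₀ K) {x y : X} (h : y ≠ x) :
    adj K _ y * combination K Φ Sum.inl A * letter K _ x = 0 := by
  induction A using Finsupp.induction_linear with
  | zero => simp
  | add B B' hB hB' => rw [map_add, mul_add, add_mul, hB, hB', add_zero]
  | single g k =>
    rw [combination_single, mul_smul_comm, smul_mul_assoc, mul_assoc, state_mul_letter, ← mul_assoc]
    simp only [msOut]
    rw [adj_mul_letter_ne K _ h, zero_mul, smul_zero]

theorem adj_mul_combination_inl_mul_letter (A : G →₀ K) {x : X} {f : G →* H}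
    (hx : Φ x = Sum.inr f) :
    adj K _ x * combination K Φ Sum.inl A * letter K _ x =
      combination K Φ Sum.inr (Finsupp.mapDomain f A) := by
  induction A using Finsupp.induction_linear with
  | zero => simp
  | add B B' hB hB' => rw [map_add, mul_add, add_mul, hB, hB', Finsupp.mapDomain_add, map_add]
  | single g k =>
    rw [combination_single, mul_smul_comm, smul_mul_assoc, mul_assoc, state_mul_letter, ← mul_assoc]
    simp only [msOut, msNext, hx]
    rw [adj_mul_letter_same, one_mul, Finsupp.mapDomain_single, combination_single]

variable {z o : X}

theorem adj_pow_mul_letter_pow (k : ℕ) :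
    adj K (multispinalGroup Φ) z ^ k * letter K _ z ^ k = 1 := by
  induction k with
  | zero => simp
  | succ k ih =>
    rw [pow_succ, pow_succ', mul_assoc, ← mul_assoc (adj K _ z), adj_mul_letter_same, one_mul, ih]

theorem adj_pow_mul_word (k : ℕ) (u : List X) (hu : u.length ≤ k) :
    adj K _ z ^ k * word K Φ u = 0 ∨
      adj K _ z ^ k * word K Φ u = adj K _ z ^ (k - u.length) := by
  induction u generalizing k with
  | nil => right; simp
  | cons y u ih =>
    obtain ⟨k, rfl⟩ : ∃ l, k = l + 1 := ⟨k - 1, by simp at hu; omega⟩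
    rw [word_cons, pow_succ, mul_assoc, ← mul_assoc (adj K _ z)]
    by_cases h : z = y
    · rw [← h, adj_mul_letter_same, one_mul, List.length_cons, Nat.add_sub_add_right]
      exact ih k (by simpa using hu)
    · left
      rw [adj_mul_letter_ne K _ h, zero_mul, mul_zero]

variable (hz : Φ z = Sum.inl 1) (hzo : o ≠ z)

include hz in
theorem state_inl_mul_letter_pow (g : G) (k : ℕ) :
    state K Φ (Sum.inl g) * letter K _ z ^ k = letter K _ z ^ k * state K Φ (Sum.inl g) := by
  have h : Commute (state K Φ (Sum.inl g)) (letter K _ z) := by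
    have := state_mul_letter (K := K) (Φ := Φ) (Sum.inl g) z
    simp only [msOut, msNext, hz, MulAut.one_apply] at this
    exact this
  exact h.pow_right k

include hfree hz hzo in
-- Only a power of z survives on the left as the word `u`. A state from `G` then commutes with z,
-- and an excess of `u.length` letters z is left on the right of o*, which kills it.
theorem corner_word_mul_state_eq_zero (k : ℕ) (u : List X) (hu : u ≠ []) (huk : u.length < k)
    (s : G ⊕ H) :
    adj K _ o * adj K _ z ^ k * (word K Φ u * state K Φ s) * (letter K _ z ^ k * letter K _ o)
      = 0 := by
  have hpos : 0 < u.length := List.length_pos_iff.2 hu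
  have split : letter K (multispinalGroup Φ) z ^ k =
      letter K _ z ^ (k - u.length) * letter K _ z * letter K _ z ^ (u.length - 1) := by
    rw [← pow_succ, ← pow_add]; congr 1; omega
  have hinl : ∀ g : G, adj K _ z ^ (k - u.length) * state K Φ (Sum.inl g) * letter K _ z ^ k =
      letter K _ z * letter K _ z ^ (u.length - 1) * state K Φ (Sum.inl g) := by
    intro g
    rw [mul_assoc, state_inl_mul_letter_pow hz, split]
    simp only [← mul_assoc]
    rw [adj_pow_mul_letter_pow, one_mul]
  have hinl' : ∀ g : G, adj K _ o * (adj K _ z ^ (k - u.length) * state K Φ (Sum.inl g) *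
      letter K _ z ^ k) = 0 := by
    intro g
    rw [hinl, mul_assoc, ← mul_assoc, adj_mul_letter_ne K _ hzo, zero_mul]
  have key : adj K _ o * (adj K _ z ^ (k - u.length) * state K Φ s * letter K _ z ^ k) = 0 := by
    cases s with
    | inl g => exact hinl' g
    | inr h =>
      by_cases h1 : h = 1
      · rw [h1, state_inr_one, ← state_inl_one]; exact hinl' 1
      -- At least one z* remains as `u.length < k`, and z* h z = 0 because a non-trivial h moves z.
      · obtain ⟨k, rfl⟩ : ∃ l, k = l + 1 := ⟨k - 1, by omega⟩
        have h2 : adj K _ z * (state K Φ (Sum.inr h) * letter K _ z) = 0 := by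
          rw [state_mul_letter, ← mul_assoc, adj_mul_letter_ne, zero_mul]
          intro h2
          exact h1 (hfree h z h2.symm)
        rw [show k + 1 - u.length = k - u.length + 1 by omega, pow_succ, pow_succ']
        rw [show ∀ p q r s t : NekrashevychAlgebra K (multispinalGroup Φ),
          p * q * r * (s * t) = p * (q * (r * s)) * t by intros; simp only [mul_assoc], h2]
        simp
  rcases adj_pow_mul_word (K := K) (Φ := Φ) (z := z) k u huk.le with h | h
  · rw [mul_assoc (adj K _ o), ← mul_assoc (adj K _ z ^ k), h]; simp
  · rw [mul_assoc (adj K _ o), ← mul_assoc (adj K _ z ^ k), h, ← mul_assoc, mul_assoc (adj K _ o),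
      key, zero_mul]

include hfree hz hzo in
theorem exists_corner_eq_zero {b} (hb : b ∈ posWordStates K Φ) :
    ∃ n, ∀ k ≥ n, adj K _ o * adj K _ z ^ k * b * (letter K _ z ^ k * letter K _ o) = 0 := by
  induction hb using Submodule.span_induction with
  | mem a ha =>
    obtain ⟨u, s, hu, rfl⟩ := ha
    exact ⟨u.length + 1, fun k hk => corner_word_mul_state_eq_zero hfree hz hzo k u hu hk s⟩
  | zero => exact ⟨0, fun k _ => by simp⟩
  | add a b _ _ ha hb =>
    obtain ⟨n, hn⟩ := ha
    obtain ⟨n', hn'⟩ := hb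
    refine ⟨max n n', fun k hk => ?_⟩
    rw [mul_add, add_mul, hn k (le_of_max_le_left hk), hn' k (le_of_max_le_right hk), add_zero]
  | smul c a _ ha =>
    obtain ⟨n, hn⟩ := ha
    exact ⟨n, fun k hk => by rw [mul_smul_comm, smul_mul_assoc, hn k hk, smul_zero]⟩

variable (J : TwoSidedIdeal (NekrashevychAlgebra K (multispinalGroup Φ)))

include hfree hz hzo in
theorem one_mem_of_scalar_add_mem {c : K} (hc : c ≠ 0) {b} (hb : b ∈ posWordStates K Φ)
    (h : c • 1 + b ∈ J) : 1 ∈ J := by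
  obtain ⟨n, hn⟩ := exists_corner_eq_zero hfree hz hzo hb
  have h1 := J.mul_mem_right _ (letter K _ z ^ n * letter K _ o)
    (J.mul_mem_left (adj K _ o * adj K _ z ^ n) _ h)
  rw [mul_add, add_mul, hn n le_rfl, add_zero, mul_smul_comm, smul_mul_assoc, mul_one,
    mul_assoc, ← mul_assoc (adj K _ z ^ n), adj_pow_mul_letter_pow, one_mul,
    adj_mul_letter_same] at h1
  have h2 := J.mul_mem_left (c⁻¹ • 1) _ h1
  rwa [smul_mul_smul_comm, inv_mul_cancel₀ hc, one_smul, mul_one] at h2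

include hfree hz hzo in
theorem one_mem_of_combination_inr_add_mem {B : H →₀ K} (hB : B ≠ 0) {b}
    (hb : b ∈ posWordStates K Φ) (h : combination K Φ Sum.inr B + b ∈ J) : 1 ∈ J := by
  obtain ⟨g, hg⟩ := Finsupp.ne_iff.1 hB
  have h1 := J.mul_mem_right _ (letter K _ z) (J.mul_mem_left (adj K _ (g • z)) _ h)
  rw [mul_add, add_mul, adj_mul_combination_inr_mul_letter hfree] at h1
  exact one_mem_of_scalar_add_mem hfree hz hzo J hg
    (adj_mul_mul_letter_mem_posWordStates hb _ _) h1

include hfree hz hzo in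
theorem one_mem_of_mem_wordStates {f : G →* H} (ho : Φ o = Sum.inr f)
    (hf : Function.Injective f) (L : ℕ) {a} (ha : a ∈ wordStates K Φ L) (ha0 : a ≠ 0)
    (haJ : a ∈ J) : 1 ∈ J := by
  induction L generalizing a with
  | zero =>
    exact absurd ((Submodule.mem_bot K).1 (by simpa [wordStates] using ha)) ha0
  | succ L ih =>
    obtain ⟨A, B, b, hb, rfl, hbL⟩ := exists_decomposition ha
    by_cases hB : ∃ h : H, h ≠ 1 ∧ B h ≠ 0
    · obtain ⟨h, h1, hBh⟩ := hB
      have h2 := J.mul_mem_right _ (letter K _ z) (J.mul_mem_left (adj K _ (h • z)) _ haJ)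
      rw [mul_add, mul_add, add_mul, add_mul, adj_mul_combination_inr_mul_letter hfree,
        adj_mul_combination_inl_mul_letter_ne A fun h3 => h1 (hfree h z h3), zero_add] at h2
      exact one_mem_of_scalar_add_mem hfree hz hzo J hBh
        (adj_mul_mul_letter_mem_posWordStates hb _ _) h2
    -- Now `B` is supported at 1. The states `inl 1` and `inr 1` both equal the unit, so `B` can be
    -- absorbed into `A`.
    · push Not at hB
      obtain ⟨A', hA'⟩ : ∃ A' : G →₀ K, combination K Φ Sum.inl A' =
          combination K Φ Sum.inl A + combination K Φ Sum.inr B := by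
        refine ⟨A + Finsupp.single 1 (B 1), ?_⟩
        have : B = Finsupp.single 1 (B 1) := by
          classical
          ext h
          rw [Finsupp.single_apply]
          split_ifs with h1
          · rw [h1]
          · exact hB h (Ne.symm h1)
        rw [map_add, combination_single]
        nth_rw 2 [this]
        rw [combination_single, state_inl_one, state_inr_one]
      rw [← hA'] at haJ ha0
      by_cases hA : A' = 0
      · rw [hA, map_zero, zero_add] at haJ ha0
        obtain ⟨x, hx⟩ := exists_adj_mul_ne_zero ha0
        exact ih (hbL x) hx (J.mul_mem_left _ _ haJ)
      -- The corner at o replaces `A'` by its push-forward along `f`, non-zero by injectivity.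
      · have h1 := J.mul_mem_right _ (letter K _ o) (J.mul_mem_left (adj K _ o) _ haJ)
        rw [mul_add, add_mul, adj_mul_combination_inl_mul_letter A' ho] at h1
        refine one_mem_of_combination_inr_add_mem hfree hz hzo J ?_
          (adj_mul_mul_letter_mem_posWordStates hb _ _) h1
        intro h2
        apply hA
        exact Finsupp.mapDomain_injective hf (by rw [h2, Finsupp.mapDomain_zero])

include hfree hz in
/-- The Nekrashevych algebra is simple if one of the homomorphisms is injective. -/
theorem isSimpleRing_of_injective {f : G →* H} (ho : Φ o = Sum.inr f)
    (hf : Function.Injective f) :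
    IsSimpleRing (NekrashevychAlgebra K (multispinalGroup Φ)) := by
  have hzo : o ≠ z := by
    rintro rfl
    rw [hz] at ho
    cases ho
  have : Nonempty X := ⟨o⟩
  refine ⟨⟨fun J => ?_⟩⟩
  by_cases hJ : ∃ a ∈ J, a ≠ 0
  · right
    obtain ⟨a, haJ, ha⟩ := hJ
    obtain ⟨L, b, hb, hb0, hbJ⟩ := exists_mem_wordStates J ha haJ
    exact J.one_mem_iff.1 (one_mem_of_mem_wordStates hfree hz hzo J ho hf L hb hb0 hbJ)
  · left
    push Not at hJ
    exact eq_bot_iff.2 fun a ha => (TwoSidedIdeal.mem_bot _).2 (hJ a ha)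

end Simplicity

end NekrashevychAlgebra

/-! ### Functions on finite cyclic groups -/

section CyclicGroups

variable {C : Type*} [Group C] [Finite C] [IsCyclic C]

/-- In a cyclic group the equation c^n = 1 has at most n solutions, and for n the order of `z` the
powers of `z` already provide n. -/
theorem mem_zpowers_of_orderOf_eq {y z : C} (h : orderOf y = orderOf z) :
    y ∈ Subgroup.zpowers z := by
  classical
  have := Fintype.ofFinite C
  have h1 : ({c | c ∈ Subgroup.zpowers z} : Finset C) =
      ({c | c ^ orderOf z = 1} : Finset C) := by
    refine Finset.eq_of_subset_of_card_le (fun c hc => ?_) ?_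
    · rw [Finset.mem_filter_univ] at hc ⊢
      obtain ⟨k, rfl⟩ := Subgroup.mem_zpowers_iff.1 hc
      rw [← zpow_natCast, ← zpow_mul, mul_comm, zpow_mul, zpow_natCast, pow_orderOf_eq_one,
        one_zpow]
    · refine (IsCyclic.card_pow_eq_one_le (orderOf_pos z)).trans_eq ?_
      rw [← Fintype.card_zpowers, Fintype.card_subtype]
  have h2 : y ∈ ({c | c ^ orderOf z = 1} : Finset C) := by
    rw [Finset.mem_filter_univ, ← h, pow_orderOf_eq_one]
  rwa [← h1, Finset.mem_filter_univ] at h2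

omit [IsCyclic C] in
theorem apply_mul_of_mem_zpowers {R : Type*} {F : C → R} {y z : C}
    (hF : ∀ c, F (y * c) = F c) (hz : z ∈ Subgroup.zpowers y) (c : C) : F (z * c) = F c := by
  obtain ⟨n, hn⟩ := mem_powers_iff_mem_zpowers.2 hz
  change y ^ n = z at hn
  rw [← hn]
  clear hn
  induction n with
  | zero => simp
  | succ n ih => rw [pow_succ', mul_assoc, hF, ih]

/-- A function on a cyclic group invariant under a non-trivial element is invariant under all
elements of some prime order. -/
theorem exists_prime_invariant {R : Type*} {F : C → R} {y : C} (hy : y ≠ 1)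
    (hF : ∀ c, F (y * c) = F c) :
    ∃ p, p.Prime ∧ p ∣ Nat.card C ∧ ∀ z, orderOf z = p → ∀ c, F (z * c) = F c := by
  obtain ⟨p, hp, hpy⟩ := Nat.exists_prime_and_dvd (mt orderOf_eq_one_iff.1 hy)
  refine ⟨p, hp, hpy.trans (orderOf_dvd_natCard y), fun z hz c => ?_⟩
  have h0 : orderOf y ≠ 0 := (orderOf_pos y).ne'
  -- All elements of order `p` are powers of this one, hence of `y`.
  have h1 : orderOf (y ^ (orderOf y / p)) = p := orderOf_pow_orderOf_div h0 hpy
  refine apply_mul_of_mem_zpowers hF ?_ c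
  exact (Subgroup.zpowers_le.2 (Subgroup.npow_mem_zpowers y _))
    (mem_zpowers_of_orderOf_eq (hz.trans h1.symm))

/-- `A` is the coefficient function of a product of factors 1 - z, one z of order p for each p in
`S`. The bound on its support shows that further factors do not disturb the coefficient at 1. -/
theorem exists_annihilating_function_aux [Fintype C] (K : Type*) [Field K] (S : Finset ℕ)
    (hS : ∀ p ∈ S, p.Prime ∧ p ∣ Nat.card C) :
    ∃ A : C → K, A 1 = 1 ∧ (∀ c, A c ≠ 0 → c ^ (∏ p ∈ S, p) = 1) ∧
      ∀ F : C → K, (∃ p ∈ S, ∀ z, orderOf z = p → ∀ c, F (z * c) = F c) →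
        ∑ c, A c * F c = 0 := by
  classical
  induction S using Finset.induction_on with
  | empty => exact ⟨Pi.single 1 1, by simp, fun c hc => by
      by_contra h; simp at h; simp [h] at hc, by simp⟩
  | insert p S hpS ih =>
    obtain ⟨A, A1, hA, hAF⟩ := ih fun q hq => hS q (Finset.mem_insert_of_mem hq)
    obtain ⟨hp, hpC⟩ := hS p (Finset.mem_insert_self _ _)
    have : Fact p.Prime := ⟨hp⟩
    obtain ⟨z, hz⟩ := exists_prime_orderOf_dvd_card' p hpC
    have hcomm : ∀ x y : C, x * y = y * x := fun x y => by
      let _ : CommGroup C := IsCyclic.commGroup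
      exact mul_comm x y
    refine ⟨fun c => A c - A (z⁻¹ * c), ?_, fun c hc => ?_, fun F hF => ?_⟩
    -- The order `p` of `z` does not divide the product of the other primes, so z⁻¹ is outside the
    -- support of `A`.
    · have : A z⁻¹ = 0 := by
        by_contra h
        have h1 := orderOf_dvd_of_pow_eq_one (hA _ h)
        rw [orderOf_inv, hz, hp.prime.dvd_finsetProd_iff] at h1
        obtain ⟨q, hq, hpq⟩ := h1
        have := (Nat.prime_dvd_prime_iff_eq hp (hS q (Finset.mem_insert_of_mem hq)).1).1 hpq
        exact hpS (this ▸ hq)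
      simp [A1, this]
    · rw [Finset.prod_insert hpS, pow_mul']
      have h : A c ≠ 0 ∨ A (z⁻¹ * c) ≠ 0 := by
        by_contra! h
        exact hc (by simp [h])
      rcases h with h | h
      · rw [hA c h, one_pow]
      · have h1 : c = z * (z⁻¹ * c) := by group
        have h2 : Commute z (z⁻¹ * c) := hcomm _ _
        rw [h1, h2.mul_pow, hA _ h, mul_one, ← pow_mul, mul_comm,
          pow_mul, ← hz, pow_orderOf_eq_one, one_pow]
    · have h1 : ∑ c, A (z⁻¹ * c) * F c = ∑ c, A c * F (z * c) := by
        rw [← Equiv.sum_comp (Equiv.mulLeft z)]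
        simp
      simp only [sub_mul, Finset.sum_sub_distrib, h1]
      obtain ⟨q, hq, hF⟩ := hF
      rw [Finset.mem_insert] at hq
      rcases hq with rfl | hq
      · simp only [hF z hz, sub_self]
      -- As the group is commutative, translating `F` by `z` preserves its invariance.
      · rw [hAF F ⟨q, hq, hF⟩, hAF (fun c => F (z * c)) ⟨q, hq, fun y hy c => ?_⟩, sub_zero]
        rw [← mul_assoc, hcomm z y, mul_assoc, hF y hy]

/-- On a cyclic group there is a non-zero function orthogonal to all functions invariant under
some non-trivial element. -/
theorem exists_annihilating_function [Fintype C] (K : Type*) [Field K] :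
    ∃ A : C → K, A 1 = 1 ∧ ∀ F : C → K, (∃ y ≠ 1, ∀ c, F (y * c) = F c) →
      ∑ c, A c * F c = 0 := by
  obtain ⟨A, A1, -, hA⟩ := exists_annihilating_function_aux (C := C) K (Nat.card C).primeFactors
    fun p hp => ⟨Nat.prime_of_mem_primeFactors hp, Nat.dvd_of_mem_primeFactors hp⟩
  refine ⟨A, A1, fun F ⟨y, hy, hF⟩ => ?_⟩
  obtain ⟨p, hp, hpC, h⟩ := exists_prime_invariant hy hF
  exact hA F ⟨p, Nat.mem_primeFactors.2 ⟨hp, hpC, Nat.card_pos.ne'⟩, h⟩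

/-- In a cyclic `p`-group, each non-injective homomorphism kills the elements of order `p`. -/
theorem map_eq_one_of_not_injective {H : Type*} [Group H] {p n : ℕ} (hp : p.Prime)
    (hC : Nat.card C = p ^ n) {f : C →* H} (hf : ¬ Function.Injective f) {z : C}
    (hz : orderOf z = p) : f z = 1 := by
  obtain ⟨y, hy, hy1⟩ : ∃ y, f y = 1 ∧ y ≠ 1 := by
    by_contra! h
    exact hf ((injective_iff_map_eq_one f).2 h)
  obtain ⟨q, hq, hqC, h⟩ := exists_prime_invariant (F := f) hy1 (by simp [hy])
  rw [hC] at hqC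
  have := (Nat.prime_dvd_prime_iff_eq hq hp).1 (hq.dvd_of_dvd_pow hqC)
  simpa using h z (hz.trans this.symm) 1

end CyclicGroups

/-! ### Germs along infinite words and the labelled representation -/

section Germs

open SelfSimilarGroup

variable {G H X : Type*} [Group G] [Group H] [MulAction H X]
variable {Φ : X → MulAut G ⊕ (G →* H)}

theorem out_msElem (s : G ⊕ H) (x : X) :
    (multispinalGroup Φ).out (msElem Φ s) x = msOut s x := out_eq (msElem_apply_cons Φ s x)

theorem sec_msElem (s : G ⊕ H) (x : X) :
    (multispinalGroup Φ).sec (msElem Φ s) x = msElem Φ (msNext Φ s x) :=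
  sec_eq (msElem_apply_cons Φ s x)

theorem msElem_inr_one : msElem Φ (Sum.inr 1) = 1 := map_one (msElemInr Φ)

theorem msElem_inl_one : msElem Φ (Sum.inl 1) = 1 := map_one (msElemInl Φ)

variable {z : X} (hz : Φ z = Sum.inl 1) (hne : ∀ x, x ≠ z → ∃ f, Φ x = Sum.inr f)

theorem secPrefix_msElem_inr (h : H) (w : ℕ → X) (n : ℕ) :
    secPrefix (msElem Φ (Sum.inr h)) w (n + 1) = 1 := by
  rw [secPrefix, sec_msElem]
  simp only [msNext]
  rw [msElem_inr_one, secPrefix_one]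

include hz in
theorem sec_msElem_inl (g : G) :
    (multispinalGroup Φ).sec (msElem Φ (Sum.inl g)) z = msElem Φ (Sum.inl g) := by
  rw [sec_msElem]
  simp only [msNext, hz, MulAut.one_apply]

include hz hne in
-- The state persists while it reads z. The first other letter turns it into a state from `H`, and
-- the letter after that into the identity; hence `j + 2`.
theorem secPrefix_msElem_inl (g : G) (w : ℕ → X) (j : ℕ) (hj : w j ≠ z) (n : ℕ) (hn : j + 2 ≤ n) :
    secPrefix (msElem Φ (Sum.inl g)) w n = 1 := by
  induction j generalizing w n with
  | zero =>
    obtain ⟨n, rfl⟩ : ∃ k, n = k + 2 := ⟨n - 2, by omega⟩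
    obtain ⟨f, hf⟩ := hne _ hj
    rw [secPrefix, sec_msElem]
    simp only [msNext, hf]
    exact secPrefix_msElem_inr _ _ _
  | succ j ih =>
    obtain ⟨n, rfl⟩ : ∃ k, n = k + 1 := ⟨n - 1, by omega⟩
    by_cases h0 : w 0 = z
    · rw [secPrefix, h0, sec_msElem_inl hz]
      exact ih _ hj _ (by omega)
    · obtain ⟨n, rfl⟩ : ∃ k, n = k + 1 := ⟨n - 1, by omega⟩
      obtain ⟨f, hf⟩ := hne _ h0
      rw [secPrefix, sec_msElem]
      simp only [msNext, hf]
      exact secPrefix_msElem_inr _ _ _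

include hz in
theorem secPrefix_msElem_const (g : G) (n : ℕ) :
    secPrefix (msElem Φ (Sum.inl g)) (fun _ => z) n = msElem Φ (Sum.inl g) := by
  induction n with
  | zero => rfl
  | succ n ih => rw [secPrefix, sec_msElem_inl hz, ih]

include hz in
theorem act_msElem_const (g : G) :
    act (msElem Φ (Sum.inl g)) (fun _ => z) = fun _ => z := by
  funext n
  induction n with
  | zero => rw [act, out_msElem]; rfl
  | succ n ih => rw [act, sec_msElem_inl hz, ih]

include hz hne in
/-- On each infinite word, the action of `G` factors through one of the homomorphisms. -/
theorem exists_act_msElem_inl_eq (w : ℕ → X) (j : ℕ) (hj : w j ≠ z) :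
    ∃ x f, Φ x = Sum.inr f ∧ ∀ g g' : G, f g = f g' →
      act (msElem Φ (Sum.inl g)) w = act (msElem Φ (Sum.inl g')) w := by
  induction j generalizing w with
  | zero =>
    obtain ⟨f, hf⟩ := hne _ hj
    refine ⟨_, f, hf, fun g g' hg => funext fun n => ?_⟩
    cases n with
    | zero => rw [act, act, out_msElem, out_msElem]; rfl
    | succ n =>
      rw [act, act, sec_msElem, sec_msElem]
      simp only [msNext, hf, hg]
  | succ j ih =>
    by_cases h0 : w 0 = z
    · obtain ⟨x, f, hf, h⟩ := ih (fun i => w (i + 1)) hj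
      refine ⟨x, f, hf, fun g g' hg => funext fun n => ?_⟩
      cases n with
      | zero => rw [act, act, out_msElem, out_msElem]; rfl
      | succ n => rw [act, act, h0, sec_msElem_inl hz, sec_msElem_inl hz, h g g' hg]
    · obtain ⟨f, hf⟩ := hne _ h0
      refine ⟨_, f, hf, fun g g' hg => funext fun n => ?_⟩
      cases n with
      | zero => rw [act, act, out_msElem, out_msElem]; rfl
      | succ n =>
        rw [act, act, sec_msElem, sec_msElem]
        simp only [msNext, hf, hg]

include hz hne in
-- The sections of a state eventually become trivial, except that those of a state from `G` along
-- zzz... are constant. Products follow from the cocycle rule for sections.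
theorem exists_germ (g : (multispinalGroup Φ).carrier) (w : ℕ → X) :
    ∃ c : G, ∃ N, ∀ n ≥ N, secPrefix g w n = msElem Φ (Sum.inl c) := by
  induction g using multispinalGroup_induction generalizing w with
  | elem s =>
    cases s with
    | inr h =>
      refine ⟨1, 1, fun n hn => ?_⟩
      obtain ⟨n, rfl⟩ : ∃ k, n = k + 1 := ⟨n - 1, by omega⟩
      rw [secPrefix_msElem_inr, msElem_inl_one]
    | inl g =>
      by_cases hw : ∃ j, w j ≠ z
      · obtain ⟨j, hj⟩ := hw
        exact ⟨1, j + 2, fun n hn => by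
          rw [secPrefix_msElem_inl hz hne g w j hj n hn, msElem_inl_one]⟩
      · push Not at hw
        obtain rfl : w = fun _ => z := funext hw
        exact ⟨g, 0, fun n _ => secPrefix_msElem_const hz g n⟩
  | one => exact ⟨1, 0, fun n _ => by rw [secPrefix_one, msElem_inl_one]⟩
  | mul g h hg hh =>
    obtain ⟨c, N, hc⟩ := hg (act h w)
    obtain ⟨d, M, hd⟩ := hh w
    refine ⟨c * d, max N M, fun n hn => ?_⟩
    rw [secPrefix_mul, hc n (le_of_max_le_left hn), hd n (le_of_max_le_right hn)]
    exact (map_mul (msElemInl Φ) c d).symm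

/-- The element of `G` which is the eventual section of `g` along an infinite word. -/
noncomputable def germ (g : (multispinalGroup Φ).carrier) (w : ℕ → X) : G :=
  (exists_germ hz hne g w).choose

theorem germ_spec (g : (multispinalGroup Φ).carrier) (w : ℕ → X) :
    ∃ N, ∀ n ≥ N, secPrefix g w n = msElem Φ (Sum.inl (germ hz hne g w)) :=
  (exists_germ hz hne g w).choose_spec

variable (hinj : Function.Injective (msElemInl Φ))

include hinj in
-- Faithfulness of `G` on words makes the germ, so far only chosen, unique.
theorem germ_eq {g : (multispinalGroup Φ).carrier} {w : ℕ → X} {c : G} {N : ℕ}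
    (h : ∀ n ≥ N, secPrefix g w n = msElem Φ (Sum.inl c)) : germ hz hne g w = c := by
  obtain ⟨M, hM⟩ := germ_spec hz hne g w
  apply hinj
  exact (hM (max N M) (le_max_right _ _)).symm.trans (h _ (le_max_left _ _))

include hinj in
theorem germ_one (w : ℕ → X) : germ hz hne 1 w = 1 :=
  germ_eq hz hne hinj (N := 0) fun n _ => by rw [secPrefix_one, msElem_inl_one]

include hinj in
-- This cocycle identity makes `actLabel` an action.
theorem germ_mul (g h : (multispinalGroup Φ).carrier) (w : ℕ → X) :
    germ hz hne (g * h) w = germ hz hne g (act h w) * germ hz hne h w := by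
  obtain ⟨N, hN⟩ := germ_spec hz hne g (act h w)
  obtain ⟨M, hM⟩ := germ_spec hz hne h w
  refine germ_eq hz hne hinj (N := max N M) fun n hn => ?_
  rw [secPrefix_mul, hN n (le_of_max_le_left hn), hM n (le_of_max_le_right hn)]
  exact (map_mul (msElemInl Φ) _ _).symm

include hinj in
-- All of `G` fixes the word zzz..., but the labels over it tell the elements of `G` apart.
theorem germ_const (g : G) : germ hz hne (msElem Φ (Sum.inl g)) (fun _ => z) = g :=
  germ_eq hz hne hinj (N := 0) fun n _ => secPrefix_msElem_const hz g n

include hinj in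
theorem germ_consEquiv_symm (g h : (multispinalGroup Φ).carrier) (x y : X)
    (hs : ∀ w, g.1 (x :: w) = y :: h.1 w) (t : ℕ → X) :
    germ hz hne g ((NekrashevychAlgebra.consEquiv X).symm (x, t)) = germ hz hne h t := by
  obtain ⟨N, hN⟩ := germ_spec hz hne h t
  refine germ_eq hz hne hinj (N := N + 1) fun n hn => ?_
  obtain ⟨n, rfl⟩ : ∃ k, n = k + 1 := ⟨n - 1, by omega⟩
  rw [← hN n (by omega), secPrefix]
  change secPrefix ((multispinalGroup Φ).sec g x) t n = _
  rw [sec_eq hs]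

/-- Splitting off the first letter of an infinite word with a label. -/
def consLabelEquiv (X G : Type*) : (ℕ → X) × G ≃ X × ((ℕ → X) × G) :=
  ((NekrashevychAlgebra.consEquiv X).prodCongr (Equiv.refl G)).trans (Equiv.prodAssoc _ _ _)

/-- The action on infinite words with a label in `G`, in which labels are multiplied by germs. -/
noncomputable def actLabel (g : (multispinalGroup Φ).carrier) (t : (ℕ → X) × G) : (ℕ → X) × G :=
  (act g t.1, germ hz hne g t.1 * t.2)

/-- The representation on functions on infinite words with a label. -/
noncomputable def repLabel (K : Type*) [Field K] [Fintype X] :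
    NekrashevychAlgebra K (multispinalGroup Φ) →ₐ[K] Module.End K ((ℕ → X) × G → K) :=
  NekrashevychAlgebra.rep K (consLabelEquiv X G) (actLabel hz hne)
    (fun t => by simp [actLabel, act_one, germ_one hz hne hinj])
    (fun g h t => by simp [actLabel, act_mul, germ_mul hz hne hinj, mul_assoc])
    (fun g h x y hs t => by
      refine Prod.ext ?_ ?_
      · exact NekrashevychAlgebra.act_consEquiv_symm g h x y hs t.1
      · exact congrArg (· * t.2) (germ_consEquiv_symm hz hne hinj g h x y hs t.1))

theorem repLabel_grp_apply (K : Type*) [Field K] [Fintype X] (g : (multispinalGroup Φ).carrier)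
    (f : (ℕ → X) × G → K) (t : (ℕ → X) × G) :
    repLabel hz hne hinj K (NekrashevychAlgebra.grp K _ g) f t = f (actLabel hz hne g⁻¹ t) :=
  NekrashevychAlgebra.rep_grp_apply K _ _ _ _ _ g f t

end Germs

/-! ### Non-simplicity when no homomorphism is injective -/

namespace NekrashevychAlgebra

open SelfSimilarGroup

variable {G H X : Type*} [Group G] [Group H] [MulAction H X] [Fintype X]
variable {Φ : X → MulAut G ⊕ (G →* H)} {z : X}

omit [Fintype X] in
theorem state_inl_inv_eq (g : G) :
    (msElem Φ (Sum.inl g))⁻¹ = msElem Φ (Sum.inl g⁻¹) := msElem_inv Φ _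

/-- The Nekrashevych algebra is not simple if none of the homomorphisms is injective. -/
theorem not_isSimpleRing [Finite G] [IsCyclic G] (K : Type*) [Field K] (hz : Φ z = Sum.inl 1)
    (hne : ∀ x, x ≠ z → ∃ f, Φ x = Sum.inr f) (hex : ∃ x, x ≠ z)
    (hinj : Function.Injective (msElemInl Φ))
    (hf : ∀ x f, Φ x = Sum.inr f → ¬ Function.Injective f) :
    ¬ IsSimpleRing (NekrashevychAlgebra K (multispinalGroup Φ)) := by
  classical
  intro hsimple
  have := Fintype.ofFinite G
  obtain ⟨A, A1, hA⟩ := exists_annihilating_function (C := G) K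
  have : Nonempty X := ⟨z⟩
  -- Group elements act on functions by pullback along their inverses, so with c⁻¹ here the value at
  -- w is the sum of the A(c) F(cw).
  let a : NekrashevychAlgebra K (multispinalGroup Φ) := ∑ c, A c • state K Φ (Sum.inl c⁻¹)
  have ha : repWords K _ a = 0 := by
    ext F w
    have h1 : repWords K _ a F w = ∑ c, A c * F (act (msElem Φ (Sum.inl c)) w) := by
      simp only [a, map_sum, map_smul, LinearMap.sum_apply, Finset.sum_apply,
        LinearMap.smul_apply, Pi.smul_apply, smul_eq_mul, state, repWords, rep_grp_apply,
        state_inl_inv_eq, inv_inv]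
    rw [h1]
    have h2 : ∃ x f, Φ x = Sum.inr f ∧ ∀ g g' : G, f g = f g' →
        act (msElem Φ (Sum.inl g)) w = act (msElem Φ (Sum.inl g')) w := by
      by_cases hw : ∃ j, w j ≠ z
      · obtain ⟨j, hj⟩ := hw
        exact exists_act_msElem_inl_eq hz hne w j hj
      · push Not at hw
        obtain rfl : w = fun _ => z := funext hw
        obtain ⟨x, hx⟩ := hex
        obtain ⟨f, hf⟩ := hne x hx
        exact ⟨x, f, hf, fun g g' _ => by rw [act_msElem_const hz, act_msElem_const hz]⟩
    obtain ⟨x, f, hxf, h3⟩ := h2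
    obtain ⟨y, hy, hy1⟩ : ∃ y, f y = 1 ∧ y ≠ 1 := by
      by_contra! h
      exact hf x f hxf ((injective_iff_map_eq_one f).2 h)
    exact hA (fun c => F (act (msElem Φ (Sum.inl c)) w)) ⟨y, hy1, fun c =>
      congrArg F (h3 _ _ (by rw [map_mul, hy, one_mul]))⟩
  -- Over a simple ring the representation on infinite words is injective.
  have ha0 : a = 0 := by
    have : Function.Injective (repWords K (multispinalGroup Φ)) :=
      (repWords K (multispinalGroup Φ)).toRingHom.injective
    exact this (ha.trans (map_zero _).symm)
  -- Evaluating at the labelled word (zzz..., 1) the image of its indicator function reads off the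
  -- coefficient `A 1`.
  have h1 : repLabel hz hne hinj K a (Pi.single ((fun _ => z), 1) 1) ((fun _ => z), 1) = 1 := by
    have h2 : ∀ c : G, actLabel hz hne (msElem Φ (Sum.inl c)) ((fun _ => z), 1) =
        ((fun _ => z), c) := fun c => by
      simp only [actLabel, act_msElem_const hz, germ_const hz hne hinj, mul_one]
    simp only [a, map_sum, map_smul, LinearMap.sum_apply, Finset.sum_apply,
      LinearMap.smul_apply, Pi.smul_apply, smul_eq_mul, state, repLabel_grp_apply,
      state_inl_inv_eq, inv_inv, h2]
    rw [Finset.sum_eq_single 1]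
    · simp [A1]
    · intro c _ hc
      simp [hc]
    · simp
  rw [ha0] at h1
  simp at h1

end NekrashevychAlgebra

/-! ### GGS-groups and Gupta–Sidki groups -/

section GGS

theorem vadd_eq_self_free (m : ℕ) (h : Multiplicative (ZMod m)) (x : ZMod m) (hx : h • x = x) :
    h = 1 := by
  change h.toAdd + x = x at hx
  exact Multiplicative.toAdd.injective (by simpa using hx)

variable {m : ℕ} [NeZero m] {C : Type*} [Group C]
  {Φ : ZMod m → MulAut C ⊕ (C →* Multiplicative (ZMod m))}

omit [NeZero m] in
theorem natCast_ne_last {k : ℕ} (hk : k + 2 ≤ m) : (k : ZMod m) ≠ ((m - 1 : ℕ) : ZMod m) := by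
  intro h
  rw [ZMod.natCast_eq_natCast_iff', Nat.mod_eq_of_lt (by omega), Nat.mod_eq_of_lt (by omega)] at h
  omega

theorem eq_last_or_exists_natCast (x : ZMod m) :
    x = ((m - 1 : ℕ) : ZMod m) ∨ ∃ k : ℕ, k + 2 ≤ m ∧ x = k := by
  have h := x.val_lt
  by_cases h1 : x.val = m - 1
  · left; rw [← h1, ZMod.natCast_zmod_val]
  · right; exact ⟨x.val, by omega, by rw [ZMod.natCast_zmod_val]⟩

namespace IsGGS

variable (hΦ : IsGGS Φ)
include hΦ

theorem exists_hom_of_ne (x : ZMod m) (hx : x ≠ ((m - 1 : ℕ) : ZMod m)) :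
    ∃ f, Φ x = Sum.inr f := by
  rcases eq_last_or_exists_natCast x with h | ⟨k, hk, rfl⟩
  · exact absurd h hx
  · exact hΦ.hom k hk

/-- The only automorphism among the Φ(x) is the identity, so `msA Φ` is trivial and `msB Φ` consists
of the Φ(k) themselves. -/
theorem eq_one_of_forall {c : C} (h : ∀ x f, Φ x = Sum.inr f → f c = 1) : c = 1 := by
  refine hΦ.ker_trivial c fun b hb => ?_
  obtain ⟨f, ⟨x, hx⟩, α, hα, rfl⟩ := hb
  have h1 : msA Φ = ⊥ := by
    rw [msA, Subgroup.closure_eq_bot_iff]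
    rintro α ⟨x, hx⟩
    rcases eq_last_or_exists_natCast x with rfl | ⟨k, hk, rfl⟩
    · rw [hΦ.last] at hx
      exact (Sum.inl.inj hx).symm
    · obtain ⟨f, hf⟩ := hΦ.hom k hk
      rw [hf] at hx
      cases hx
  rw [h1, Subgroup.mem_bot] at hα
  subst hα
  exact h x f hx

theorem msElemInl_injective : Function.Injective (msElemInl Φ) := by
  refine (injective_iff_map_eq_one _).2 fun c hc => hΦ.eq_one_of_forall fun x f hx => ?_
  -- On the word xx the first letter is fixed and the second is translated by `f c`.
  have h1 := DFunLike.congr_fun (congrArg Subtype.val hc) [x, x]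
  change [x, _] = [x, x] at h1
  simp only [msNext, hx, msOut, List.cons.injEq, and_true, true_and] at h1
  exact vadd_eq_self_free m _ _ h1

omit [NeZero m] in
theorem bijective_of_injective {f : C →* Multiplicative (ZMod m)} (hf : Function.Injective f) :
    Function.Bijective f := by
  have := hΦ.finite_right
  refine (Nat.bijective_iff_injective_and_card f).2 ⟨hf, ?_⟩
  rw [hΦ.card_eq]
  exact (Nat.card_zmod m).symm

theorem isSimpleRing {k : ℕ} {f : C →* Multiplicative (ZMod m)} (hf : Φ (k : ZMod m) = Sum.inr f)
    (hinj : Function.Injective f) (K : Type*) [Field K] :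
    IsSimpleRing (NekrashevychAlgebra K (multispinalGroup Φ)) :=
  NekrashevychAlgebra.isSimpleRing_of_injective (vadd_eq_self_free m) hΦ.last hf hinj

theorem not_isSimpleRing (hm : 2 ≤ m)
    (h : ¬ ∃ k : ℕ, k + 2 ≤ m ∧ ∃ f : C →* Multiplicative (ZMod m),
      Φ (k : ZMod m) = Sum.inr f ∧ Function.Bijective f) (K : Type*) [Field K] :
    ¬ IsSimpleRing (NekrashevychAlgebra K (multispinalGroup Φ)) := by
  have := hΦ.finite_left
  have := hΦ.cyclic
  refine NekrashevychAlgebra.not_isSimpleRing K hΦ.last hΦ.exists_hom_of_ne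
    ⟨((0 : ℕ) : ZMod m), natCast_ne_last (by omega)⟩ hΦ.msElemInl_injective fun x f hx hf => ?_
  rcases eq_last_or_exists_natCast x with rfl | ⟨k, hk, rfl⟩
  · rw [hΦ.last] at hx
    cases hx
  · exact h ⟨k, hk, f, hx, hΦ.bijective_of_injective hf⟩

/-- Otherwise an element of order p would lie in all kernels, against the triviality of their
intersection. -/
theorem exists_injective_of_isPrimePow (hm : IsPrimePow m) :
    ∃ (k : ℕ) (f : C →* Multiplicative (ZMod m)),
      Φ (k : ZMod m) = Sum.inr f ∧ Function.Injective f := by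
  have := hΦ.finite_left
  have := hΦ.cyclic
  by_contra! h
  obtain ⟨p, n, hp, hn, hpn⟩ := (isPrimePow_nat_iff m).1 hm
  have : Fact p.Prime := ⟨hp⟩
  have hC : Nat.card C = p ^ n := hΦ.card_eq.trans hpn.symm
  obtain ⟨z, hz⟩ := exists_prime_orderOf_dvd_card' (G := C) p (hC ▸ dvd_pow_self p hn.ne')
  have hz1 : z = 1 := hΦ.eq_one_of_forall fun x f hx => by
    rw [← ZMod.natCast_zmod_val x] at hx
    exact map_eq_one_of_not_injective hp hC (h _ f hx) hz
  rw [hz1, orderOf_one] at hz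
  exact hp.one_lt.ne hz

end IsGGS

namespace IsGuptaSidki

variable {t : C} (hΦ : IsGuptaSidki t Φ)
include hΦ

theorem exists_bijective : ∃ f, Φ 0 = Sum.inr f ∧ Function.Bijective f := by
  obtain ⟨f, hf, hft⟩ := hΦ.zero
  have : Finite C := Nat.finite_of_card_ne_zero (by rw [hΦ.card_eq]; exact hΦ.prime.ne_zero)
  refine ⟨f, hf, (Nat.bijective_iff_surjective_and_card f).2 ⟨fun a => ?_, ?_⟩⟩
  -- As `f` maps t to the generator 1, the residue itself serves as the exponent.
  · refine ⟨t ^ a.toAdd.val, Multiplicative.toAdd.injective ?_⟩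
    rw [map_pow, hft, toAdd_pow, toAdd_ofAdd, nsmul_eq_mul, mul_one, ZMod.natCast_zmod_val]
  · rw [hΦ.card_eq]
    exact (Nat.card_zmod m).symm

theorem isGGS : IsGGS Φ := by
  have hm := hΦ.prime.two_le
  obtain ⟨f, hf, hfb⟩ := hΦ.exists_bijective
  exact
    { finite_left := Nat.finite_of_card_ne_zero (by rw [hΦ.card_eq]; exact hΦ.prime.ne_zero)
      finite_right := inferInstanceAs (Finite (ZMod m))
      free := vadd_eq_self_free m
      exists_aut := ⟨_, _, hΦ.last⟩
      exists_hom := ⟨_, _, hf⟩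
      ker_trivial := fun g hg => (injective_iff_map_eq_one f).1 hfb.1 g
        (hg f ⟨f, ⟨0, hf⟩, 1, one_mem _, rfl⟩)
      cyclic := isCyclic_iff_exists_zpowers_eq_top.2 ⟨t, hΦ.gen⟩
      card_eq := hΦ.card_eq
      last := hΦ.last
      hom := fun k hk => by
        rcases k with _ | _ | k
        · exact ⟨f, by rw [Nat.cast_zero, hf]⟩
        · obtain ⟨f, hf, -⟩ := hΦ.one
          exact ⟨f, by rw [zero_add, Nat.cast_one, hf]⟩
        · obtain ⟨f, hf, -⟩ := hΦ.rest (k + 2) (by omega) hk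
          exact ⟨f, hf⟩ }

end IsGuptaSidki

end GGS

theorem theoremt {m : ℕ} [NeZero m] (hm : 2 ≤ m) {C : Type v} [Group C]
    (Φ : ZMod m → MulAut C ⊕ (C →* Multiplicative (ZMod m))) :
    (IsGGS Φ →
      ((∃ k : ℕ, k + 2 ≤ m ∧ ∃ f : C →* Multiplicative (ZMod m),
          Φ (k : ZMod m) = Sum.inr f ∧ Function.Bijective f) →
        ∀ (K : Type u) [Field K], IsSimpleRing (NekrashevychAlgebra K (multispinalGroup Φ))) ∧
      ((¬ ∃ k : ℕ, k + 2 ≤ m ∧ ∃ f : C →* Multiplicative (ZMod m),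
          Φ (k : ZMod m) = Sum.inr f ∧ Function.Bijective f) →
        ∀ (K : Type u) [Field K], ¬ IsSimpleRing (NekrashevychAlgebra K (multispinalGroup Φ))) ∧
      (IsPrimePow m →
        ∀ (K : Type u) [Field K], IsSimpleRing (NekrashevychAlgebra K (multispinalGroup Φ)))) ∧
    (∀ t : C, IsGuptaSidki t Φ →
      ∀ (K : Type u) [Field K], IsSimpleRing (NekrashevychAlgebra K (multispinalGroup Φ))) := by
  refine ⟨fun hΦ => ⟨?_, fun h K _ => hΦ.not_isSimpleRing hm h K, fun hp K _ => ?_⟩,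
    fun t ht K _ => ?_⟩
  · rintro ⟨k, -, f, hf, hfb⟩ K _
    exact hΦ.isSimpleRing hf hfb.1 K
  · obtain ⟨k, f, hf, hinj⟩ := hΦ.exists_injective_of_isPrimePow hp
    exact hΦ.isSimpleRing hf hinj K
  · obtain ⟨f, hf, hfb⟩ := ht.exists_bijective
    exact ht.isGGS.isSimpleRing (k := 0) (by rw [Nat.cast_zero, hf]) hfb.1 K
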